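/- **Definitions.** A *Markov category* is a symmetric monoidal category $\mathcal{C}$ whose unit $I$ is terminal and in which every object $X$ carries a distinguished morphism $\mathrm{copy}_X : X \to X \otimes X$ making it, together with the unique morphism $X \to I$, a commutative comonoid, compatibly with $\otimes$: $\mathrm{copy}_{X \otimes Y}$ is $\mathrm{copy}_X \otimes \mathrm{copy}_Y$ followed by the swap of the two middle factors. A morphism $f : X \to Y$ is *deterministic* if $\mathrm{copy}_Y \circ f = (f \otimes f) \circ \mathrm{copy}_X$. The deterministic morphisms form a wide subcategory $\mathcal{C}_{\det}$, which is cartesian monoidal for the structure inherited from $\mathcal{C}$, the diagonals being the copy maps. A *distribution object* for $X$ is an object $PX$ with a morphism $\mathrm{samp} : PX \to X$ such that $f \mapsto \mathrm{samp} \circ f$ is a bijection $\mathcal{C}_{\det}(A, PX) \to \mathcal{C}(A, X)$ for every object $A$. The Markov category $\mathcal{C}$ is *representable* if every object has a distribution object. A *symmetric monoidal monad* on a cartesian monoidal category $\mathcal{D}$ is a monad $(P, E, \delta)$ whose functor is symmetric lax monoidal, with structure maps $\nabla : PX \times PY \to P(X \times Y)$, and whose multiplication $E$ and unit $\delta$ are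 monoidal transformations; it is *affine* if $P(1) \cong 1$. For such an affine $P$, the Kleisli category $\mathrm{Kl}(P)$ is a Markov category: on objects the tensor product is the product of $\mathcal{D}$, the tensor product of the Kleisli morphisms represented by $f : A \to PX$ and $g : B \to PY$ is represented by $\nabla \circ (f \times g)$, and the structure isomorphisms and copy maps are the images of those isomorphisms and of the diagonals of $\mathcal{D}$ under the canonical functor $\mathcal{D} \to \mathrm{Kl}(P)$. An *isomorphism of Markov categories* is an isomorphism of categories that is a strict symmetric monoidal functor and preserves the copy maps. **Theorem.** For a Markov category $\mathcal{C}$, the following are equivalent: 1. $\mathcal{C}$ is representable. 2. There is an affine symmetric monoidal monad $(P, E, \delta)$ on $\mathcal{C}_{\det}$ such that - for every object $X$, the square in $\mathcal{C}_{\det}$ with sides $\delta : X \to PX$, $(\delta, \delta) : X \to PX \times PX$, $P(\mathrm{id}, \mathrm{id}) : PX \to P(X \times X)$ and $\nabla : PX \times PX \to P(X \times X)$ is a pullback, and - the identity functor on $\mathcal{C}_{\det}$ extends to an isomorphism of Markov categories $\Phi : \mathcal{C} \cong \mathrm{Kl}(P)$; that is, $\Phi$ composed with the inclusion $\mathcal{C}_{\det}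 \hookrightarrow \mathcal{C}$ is the canonical functor $\mathcal{C}_{\det} \to \mathrm{Kl}(P)$. -/

import Mathlib

universe v u

namespace CategoryTheory

open MonoidalCategory ComonObj Limits

theorem tensorμ_braiding {C : Type u} [Category.{v} C] [MonoidalCategory C] [SymmetricCategory C]
    (X Y : C) :
    (β_ (X ⊗ X) (Y ⊗ Y)).hom ≫ tensorμ Y Y X X =
      tensorμ X X Y Y ≫ ((β_ X Y).hom ⊗ₘ (β_ X Y).hom) := by
  simp only [tensorμ, Category.assoc,
    BraidedCategory.braiding_tensor_right_hom, BraidedCategory.braiding_tensor_left_hom,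
    comp_whiskerRight, whisker_assoc, MonoidalCategory.whiskerLeft_comp, pentagon_assoc,
    pentagon_inv_hom_hom_hom_inv_assoc, Iso.inv_hom_id_assoc, whiskerLeft_hom_inv_assoc]
  have h : Y ◁ (β_ X Y).hom ▷ X ≫ Y ◁ (β_ Y X).hom ▷ X = 𝟙 _ := by
    rw [← MonoidalCategory.whiskerLeft_comp, ← comp_whiskerRight, SymmetricCategory.symmetry]
    simp
  rw [reassoc_of% h, MonoidalCategory.tensorHom_def]
  simp

theorem tensorμ_tensorμ {C : Type u} [Category.{v} C] [MonoidalCategory C] [SymmetricCategory C]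
    (X₁ X₂ Y₁ Y₂ : C) :
    tensorμ X₁ X₂ Y₁ Y₂ ≫ tensorμ X₁ Y₁ X₂ Y₂ = 𝟙 _ := by
  rw [← tensorμ_tensorδ]
  simp [tensorμ, tensorδ, SymmetricCategory.braiding_swap_eq_inv_braiding]

section Deterministic

variable {C : Type u} [Category.{v} C] [MonoidalCategory C] [MarkovCategory C]

variable (C) in
/-- The class of deterministic morphisms of a Markov category. -/
def deterministic : MorphismProperty C := fun _ _ f => Deterministic f

theorem deterministic_iff {X Y : C} (f : X ⟶ Y) :
    deterministic C f ↔ f ≫ Δ[Y] = Δ[X] ≫ (f ⊗ₘ f) :=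
  ⟨fun h => h.hom_comul, fun h => ⟨MarkovCategory.discard_natural f, h⟩⟩

theorem deterministic_inv {X Y : C} (e : X ≅ Y) (h : deterministic C e.hom) :
    deterministic C e.inv :=
  haveI : IsComonHom e.hom := h
  (inferInstance : IsComonHom e.inv)

instance : (deterministic C).IsMultiplicative where
  id_mem X := (inferInstance : IsComonHom (𝟙 X))
  comp_mem f g hf hg :=
    haveI : IsComonHom f := hf
    haveI : IsComonHom g := hg
    (inferInstance : IsComonHom (f ≫ g))

theorem deterministic_copy (X : C) : deterministic C Δ[X] := by
  rw [deterministic_iff, CopyDiscardCategory.copy_tensor]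
  have h : Δ[X] ≫ (Δ[X] ⊗ₘ Δ[X]) =
      Δ[X] ≫ X ◁ Δ[X] ≫ X ◁ Δ[X] ▷ X ≫ X ◁ (α_ X X X).hom ≫ (α_ X X (X ⊗ X)).inv := by
    rw [MonoidalCategory.tensorHom_def, ComonObj.comul_assoc_flip_assoc,
      ← associator_inv_naturality_right, ← MonoidalCategory.whiskerLeft_comp_assoc,
      ComonObj.comul_assoc]
    simp
  have hc : X ◁ Δ[X] ▷ X ≫ X ◁ (β_ X X).hom ▷ X = X ◁ Δ[X] ▷ X := by
    rw [← MonoidalCategory.whiskerLeft_comp, ← comp_whiskerRight, IsCommComonObj.comul_comm]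
  rw [reassoc_of% h, h]
  simp [tensorμ, reassoc_of% hc]

theorem deterministic_associator (X Y Z : C) : deterministic C (α_ X Y Z).hom := by
  rw [deterministic_iff]
  simp only [CopyDiscardCategory.copy_tensor]
  have h : (tensorμ X X Y Y ▷ (Z ⊗ Z)) ≫ tensorμ (X ⊗ Y) (X ⊗ Y) Z Z ≫
      ((α_ X Y Z).hom ⊗ₘ (α_ X Y Z).hom) =
      (α_ (X ⊗ X) (Y ⊗ Y) (Z ⊗ Z)).hom ≫ ((X ⊗ X) ◁ tensorμ Y Y Z Z) ≫
        tensorμ X X (Y ⊗ Z) (Y ⊗ Z) := by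
    have h := associator_monoidal X Y Z X Y Z =≫
      ((X ⊗ X) ◁ tensorμ Y Y Z Z ≫ tensorμ X X (Y ⊗ Z) (Y ⊗ Z))
    simp only [Category.assoc, ← MonoidalCategory.whiskerLeft_comp_assoc, tensorμ_tensorμ,
      MonoidalCategory.whiskerLeft_id, Category.id_comp, Category.comp_id] at h
    rw [← h, reassoc_of% tensorμ_tensorμ, ← comp_whiskerRight_assoc, tensorμ_tensorμ]
    simp
  have e₁ : ((Δ[X] ⊗ₘ Δ[Y]) ≫ tensorμ X X Y Y) ⊗ₘ Δ[Z] =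
      ((Δ[X] ⊗ₘ Δ[Y]) ⊗ₘ Δ[Z]) ≫ tensorμ X X Y Y ▷ (Z ⊗ Z) := by
    rw [← tensorHom_id, tensorHom_comp_tensorHom, Category.comp_id]
  have e₂ : Δ[X] ⊗ₘ ((Δ[Y] ⊗ₘ Δ[Z]) ≫ tensorμ Y Y Z Z) =
      (Δ[X] ⊗ₘ (Δ[Y] ⊗ₘ Δ[Z])) ≫ (X ⊗ X) ◁ tensorμ Y Y Z Z := by
    rw [← id_tensorHom, tensorHom_comp_tensorHom, Category.comp_id]
  rw [e₁, e₂]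
  simp only [Category.assoc, h]
  rw [associator_naturality_assoc]

theorem deterministic_leftUnitor (X : C) : deterministic C (λ_ X).hom := by
  rw [deterministic_iff]
  simp only [CopyDiscardCategory.copy_tensor, CopyDiscardCategory.copy_unit]
  rw [leftUnitor_monoidal, Category.assoc, reassoc_of% tensorμ_tensorμ, MonoidalCategory.tensorHom_def']
  simp

theorem deterministic_rightUnitor (X : C) : deterministic C (ρ_ X).hom := by
  rw [deterministic_iff]
  simp only [CopyDiscardCategory.copy_tensor, CopyDiscardCategory.copy_unit]
  rw [rightUnitor_monoidal, Category.assoc, reassoc_of% tensorμ_tensorμ, MonoidalCategory.tensorHom_def]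
  simp

theorem deterministic_braiding (X Y : C) : deterministic C (β_ X Y).hom := by
  rw [deterministic_iff]
  simp only [CopyDiscardCategory.copy_tensor, Category.assoc]
  rw [← tensorμ_braiding, BraidedCategory.braiding_naturality_assoc]

instance : (deterministic C).IsMonoidal :=
  .mk' _ fun {X₁ X₂ Y₁ Y₂} f g hf hg => by
    rw [deterministic_iff] at hf hg ⊢
    simp only [CopyDiscardCategory.copy_tensor, Category.assoc, ← tensorμ_natural,
      tensorHom_comp_tensorHom_assoc, hf, hg]


instance : (deterministic C).IsMonoidalStable where
  associator_hom_mem := deterministic_associator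
  associator_inv_mem X Y Z := deterministic_inv _ (deterministic_associator X Y Z)
  leftUnitor_hom_mem := deterministic_leftUnitor
  leftUnitor_inv_mem X := deterministic_inv _ (deterministic_leftUnitor X)
  rightUnitor_hom_mem := deterministic_rightUnitor
  rightUnitor_inv_mem X := deterministic_inv _ (deterministic_rightUnitor X)

instance : (deterministic C).IsStableUnderBraiding where
  braiding_hom_mem := deterministic_braiding
  braiding_inv_mem X Y := deterministic_inv _ (deterministic_braiding X Y)

variable (C) in
/-- The subcategory `C_det` of deterministic morphisms of a Markov category, with the symmetric
monoidal structure inherited from `C`. -/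
abbrev Det := WideSubcategory (deterministic C)

variable (C) in
/-- The inclusion functor of `C_det` into `C`. -/
abbrev Det.incl : Det C ⥤ C := wideSubcategoryInclusion (deterministic C)

theorem deterministic_discard (X : C) : deterministic C ε[X] := by
  rw [deterministic_iff, CopyDiscardCategory.copy_unit, ← cancel_mono (λ_ (𝟙_ C)).hom]
  exact MarkovCategory.isTerminalUnit.hom_ext _ _

theorem copy_fst {T X Y : C} (f : T ⟶ X) (g : T ⟶ Y) :
    (Δ[T] ≫ (f ⊗ₘ g)) ≫ X ◁ ε[Y] ≫ (ρ_ X).hom = f := by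
  rw [← id_tensorHom, Category.assoc, tensorHom_comp_tensorHom_assoc, Category.comp_id,
    MarkovCategory.discard_natural, MonoidalCategory.tensorHom_def', Category.assoc,
    ComonObj.comul_counit_assoc]
  simp

theorem copy_snd {T X Y : C} (f : T ⟶ X) (g : T ⟶ Y) :
    (Δ[T] ≫ (f ⊗ₘ g)) ≫ ε[X] ▷ Y ≫ (λ_ Y).hom = g := by
  rw [← tensorHom_id, Category.assoc, tensorHom_comp_tensorHom_assoc, Category.comp_id,
    MarkovCategory.discard_natural, MonoidalCategory.tensorHom_def, Category.assoc,
    ComonObj.counit_comul_assoc]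
  simp

theorem copy_fst_snd (X Y : C) :
    ((Δ[X] ⊗ₘ Δ[Y]) ≫ tensorμ X X Y Y) ≫
      ((X ◁ ε[Y] ≫ (ρ_ X).hom) ⊗ₘ (ε[X] ▷ Y ≫ (λ_ Y).hom)) = 𝟙 (X ⊗ Y) := by
  have h₀ : tensorμ X (𝟙_ C) (𝟙_ C) Y ≫ ((ρ_ X).hom ⊗ₘ (λ_ Y).hom) =
      (ρ_ X).hom ⊗ₘ (λ_ Y).hom := by
    have : (β_ (𝟙_ C) (𝟙_ C)).hom = 𝟙 _ := by
      rw [← cancel_mono (λ_ (𝟙_ C)).hom]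
      exact MarkovCategory.isTerminalUnit.hom_ext _ _
    rw [tensorμ, this]
    monoidal
  have h : tensorμ X X Y Y ≫ ((X ◁ ε[Y] ≫ (ρ_ X).hom) ⊗ₘ (ε[X] ▷ Y ≫ (λ_ Y).hom)) =
      ((X ◁ ε[X] ≫ (ρ_ X).hom) ⊗ₘ (ε[Y] ▷ Y ≫ (λ_ Y).hom)) := by
    rw [← tensorHom_comp_tensorHom, ← id_tensorHom, ← tensorHom_id, ← tensorμ_natural_assoc, h₀,
      tensorHom_comp_tensorHom, id_tensorHom, tensorHom_id]
  rw [Category.assoc, h, tensorHom_comp_tensorHom]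
  simp

theorem Det.eq_lift {T : C} {X Y : C} (m : T ⟶ X ⊗ Y) (hm : deterministic C m) :
    m = Δ[T] ≫ ((m ≫ X ◁ ε[Y] ≫ (ρ_ X).hom) ⊗ₘ (m ≫ ε[X] ▷ Y ≫ (λ_ Y).hom)) := by
  rw [← tensorHom_comp_tensorHom, ← Category.assoc, ← (deterministic_iff m).1 hm,
    CopyDiscardCategory.copy_tensor, Category.assoc, copy_fst_snd, Category.comp_id]

/-- `C_det` is cartesian monoidal: the pairing of `f` and `g` is copying followed by `f ⊗ g`. -/
instance Det.cartesianMonoidalCategory : CartesianMonoidalCategory (Det C) where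
  isTerminalTensorUnit := IsTerminal.ofUniqueHom (fun X => ⟨ε[X.obj], deterministic_discard X.obj⟩)
    fun X f => by ext; exact MarkovCategory.isTerminalUnit.hom_ext _ _
  fst X Y := X ◁ (⟨ε[Y.obj], deterministic_discard Y.obj⟩ : Y ⟶ 𝟙_ (Det C)) ≫ (ρ_ X).hom
  snd X Y := (⟨ε[X.obj], deterministic_discard X.obj⟩ : X ⟶ 𝟙_ (Det C)) ▷ Y ≫ (λ_ Y).hom
  fst_def _ _ := rfl
  snd_def _ _ := rfl
  tensorProductIsBinaryProduct X Y := BinaryFan.IsLimit.mk _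
    (fun {T} f g => (⟨Δ[T.obj], deterministic_copy T.obj⟩ : T ⟶ T ⊗ T) ≫ (f ⊗ₘ g))
    (fun {T} f g => by
      ext
      exact copy_fst f.hom g.hom)
    (fun {T} f g => by
      ext
      exact copy_snd f.hom g.hom)
    (fun {T} f g m h₁ h₂ => by
      ext
      subst h₁ h₂
      exact Det.eq_lift m.hom m.property)

end Deterministic

section Kleisli

open CartesianMonoidalCategory

variable {D : Type u} [Category.{v} D]

/-- A symmetric monoidal monad: a monad whose underlying functor is symmetric lax monoidal and
whose unit and multiplication are monoidal natural transformations. -/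
class Monad.SymmetricMonoidal [MonoidalCategory D] [BraidedCategory D] (T : Monad D) where
  laxBraided : T.toFunctor.LaxBraided
  isMonoidal_η : NatTrans.IsMonoidal T.η
  isMonoidal_μ : NatTrans.IsMonoidal T.μ

attribute [reducible] Monad.SymmetricMonoidal.laxBraided
attribute [instance] Monad.SymmetricMonoidal.laxBraided Monad.SymmetricMonoidal.isMonoidal_η
  Monad.SymmetricMonoidal.isMonoidal_μ

/-- The structure maps `∇ : T X ⊗ T Y ⟶ T (X ⊗ Y)` of a symmetric monoidal monad. -/
abbrev Monad.nabla [MonoidalCategory D] [BraidedCategory D] (T : Monad D) [T.SymmetricMonoidal]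
    (X Y : D) : T.obj X ⊗ T.obj Y ⟶ T.obj (X ⊗ Y) :=
  Functor.LaxMonoidal.μ T.toFunctor X Y

/-- A monad on a cartesian monoidal category is affine if it preserves the terminal object. -/
class Monad.Affine [CartesianMonoidalCategory D] (T : Monad D) : Prop where
  nonempty_iso : Nonempty (T.obj (𝟙_ D) ≅ 𝟙_ D)

namespace Kleisli

variable {T : Monad D}

theorem id_eq_toKleisli (X : Kleisli T) : 𝟙 X = (Adjunction.toKleisli T).map (𝟙 X.of) :=
  ((Adjunction.toKleisli T).map_id X.of).symm

theorem comp_toKleisli_of {A B : Kleisli T} {Y : D} (f : A ⟶ B) (g : B.of ⟶ Y) :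
    (f ≫ (Adjunction.toKleisli T).map g : A ⟶ Kleisli.mk T Y).of = f.of ≫ T.map g := by
  change f.of ≫ T.map (g ≫ T.η.app Y) ≫ T.μ.app Y = _
  simp

theorem toKleisli_comp_of {A : D} {B X : Kleisli T} (g : A ⟶ B.of) (f : B ⟶ X) :
    ((Adjunction.toKleisli T).map g ≫ f : Kleisli.mk T A ⟶ X).of = g ≫ f.of := by
  change (g ≫ T.η.app B.of) ≫ T.map f.of ≫ T.μ.app X.of = _
  have := T.η.naturality_assoc f.of (T.μ.app X.of)
  simp at this
  simp [← this]

section Monoidal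

variable [MonoidalCategory D] [BraidedCategory D] (T) [T.SymmetricMonoidal]

theorem η_nabla (X Y : D) :
    (T.η.app X ⊗ₘ T.η.app Y) ≫ T.nabla X Y = T.η.app (X ⊗ Y) := by
  have := NatTrans.IsMonoidal.tensor (τ := T.η) X Y
  simpa using this.symm

theorem μ_nabla (X Y : D) :
    (T.μ.app X ⊗ₘ T.μ.app Y) ≫ T.nabla X Y =
      T.nabla (T.obj X) (T.obj Y) ≫ T.map (T.nabla X Y) ≫ T.μ.app (X ⊗ Y) := by
  have := NatTrans.IsMonoidal.tensor (τ := T.μ) X Y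
  simpa using this.symm

theorem nabla_natural {X X' Y Y' : D} (f : X ⟶ X') (g : Y ⟶ Y') :
    (T.map f ⊗ₘ T.map g) ≫ T.nabla X' Y' = T.nabla X Y ≫ T.map (f ⊗ₘ g) :=
  Functor.LaxMonoidal.μ_natural T.toFunctor f g

theorem ε_eq : Functor.LaxMonoidal.ε T.toFunctor = T.η.app (𝟙_ D) := by
  have := NatTrans.IsMonoidal.unit (τ := T.η)
  simpa using this.symm

variable {T}

/-- The tensor product of Kleisli morphisms represented by `f : A ⟶ T X` and `g : B ⟶ T Y` is
represented by `(f ⊗ g) ≫ ∇`. -/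
def tensorHom {A X B Y : Kleisli T} (f : A ⟶ X) (g : B ⟶ Y) :
    Kleisli.mk T (A.of ⊗ B.of) ⟶ Kleisli.mk T (X.of ⊗ Y.of) :=
  .mk ((f.of ⊗ₘ g.of) ≫ T.nabla X.of Y.of)

/-- The tensor product on `Kl(T)` is that of `D` on objects, and its structure isomorphisms are the
images of those of `D`. -/
instance : MonoidalCategoryStruct (Kleisli T) where
  tensorObj X Y := .mk T (X.of ⊗ Y.of)
  tensorHom f g := tensorHom f g
  whiskerLeft X _ _ f := tensorHom (𝟙 X) f
  whiskerRight f Y := tensorHom f (𝟙 Y)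
  tensorUnit := .mk T (𝟙_ D)
  associator X Y Z := (Adjunction.toKleisli T).mapIso (α_ X.of Y.of Z.of)
  leftUnitor X := (Adjunction.toKleisli T).mapIso (λ_ X.of)
  rightUnitor X := (Adjunction.toKleisli T).mapIso (ρ_ X.of)

theorem tensorHom_of {A X B Y : Kleisli T} (f : A ⟶ X) (g : B ⟶ Y) :
    (f ⊗ₘ g).of = (f.of ⊗ₘ g.of) ≫ T.nabla X.of Y.of := rfl

theorem tensor_toKleisli {A X B Y : D} (f : A ⟶ X) (g : B ⟶ Y) :
    (Adjunction.toKleisli T).map f ⊗ₘ (Adjunction.toKleisli T).map g =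
      (Adjunction.toKleisli T).map (f ⊗ₘ g) := by
  ext
  change ((f ≫ T.η.app X) ⊗ₘ (g ≫ T.η.app Y)) ≫ T.nabla X Y = (f ⊗ₘ g) ≫ T.η.app (X ⊗ Y)
  rw [← tensorHom_comp_tensorHom, Category.assoc, η_nabla]

instance : MonoidalCategory (Kleisli T) := .ofTensorHom
  (id_tensorHom_id := fun X Y => by
    ext
    exact η_nabla T X.of Y.of)
  (id_tensorHom := fun _ _ _ _ => rfl)
  (tensorHom_id := fun _ _ => rfl)
  (tensorHom_comp_tensorHom := fun {X₁ Y₁ Z₁ X₂ Y₂ Z₂} f₁ f₂ g₁ g₂ => by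
    ext
    change ((f₁.of ⊗ₘ f₂.of) ≫ T.nabla Y₁.of Y₂.of) ≫
      T.map ((g₁.of ⊗ₘ g₂.of) ≫ T.nabla Z₁.of Z₂.of) ≫ T.μ.app (Z₁.of ⊗ Z₂.of) =
      ((f₁.of ≫ T.map g₁.of ≫ T.μ.app Z₁.of) ⊗ₘ (f₂.of ≫ T.map g₂.of ≫ T.μ.app Z₂.of)) ≫
        T.nabla Z₁.of Z₂.of
    rw [← tensorHom_comp_tensorHom, ← tensorHom_comp_tensorHom, Category.assoc, Category.assoc,
      Category.assoc, μ_nabla, reassoc_of% nabla_natural, Functor.map_comp, Category.assoc])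
  (associator_naturality := fun {X₁ X₂ X₃ Y₁ Y₂ Y₃} f₁ f₂ f₃ => by
    ext
    refine (comp_toKleisli_of _ _).trans (.trans ?_ (toKleisli_comp_of _ _).symm)
    change ((((f₁.of ⊗ₘ f₂.of) ≫ T.nabla _ _) ⊗ₘ f₃.of) ≫ T.nabla _ _) ≫ T.map _ =
      _ ≫ (f₁.of ⊗ₘ ((f₂.of ⊗ₘ f₃.of) ≫ T.nabla _ _)) ≫ T.nabla _ _
    have e₁ : ((f₁.of ⊗ₘ f₂.of) ≫ T.nabla Y₁.of Y₂.of) ⊗ₘ f₃.of =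
        ((f₁.of ⊗ₘ f₂.of) ⊗ₘ f₃.of) ≫ T.nabla Y₁.of Y₂.of ▷ T.obj Y₃.of := by
      rw [← MonoidalCategory.tensorHom_id, tensorHom_comp_tensorHom, Category.comp_id]
    have e₂ : f₁.of ⊗ₘ ((f₂.of ⊗ₘ f₃.of) ≫ T.nabla Y₂.of Y₃.of) =
        (f₁.of ⊗ₘ (f₂.of ⊗ₘ f₃.of)) ≫ T.obj Y₁.of ◁ T.nabla Y₂.of Y₃.of := by
      rw [← MonoidalCategory.id_tensorHom, tensorHom_comp_tensorHom, Category.comp_id]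
    rw [e₁, e₂, Category.assoc, Category.assoc, Category.assoc,
      Functor.LaxMonoidal.associativity, MonoidalCategory.associator_naturality_assoc])
  (leftUnitor_naturality := fun {X Y} f => by
    ext
    refine (comp_toKleisli_of _ _).trans (.trans ?_ (toKleisli_comp_of _ _).symm)
    change ((T.η.app (𝟙_ D) ⊗ₘ f.of) ≫ T.nabla _ _) ≫ T.map (λ_ Y.of).hom = (λ_ X.of).hom ≫ f.of
    rw [← ε_eq, MonoidalCategory.tensorHom_def', Category.assoc, Category.assoc,
      ← Functor.LaxMonoidal.left_unitality]
    exact MonoidalCategory.leftUnitor_naturality f.of)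
  (rightUnitor_naturality := fun {X Y} f => by
    ext
    refine (comp_toKleisli_of _ _).trans (.trans ?_ (toKleisli_comp_of _ _).symm)
    change ((f.of ⊗ₘ T.η.app (𝟙_ D)) ≫ T.nabla _ _) ≫ T.map (ρ_ Y.of).hom = (ρ_ X.of).hom ≫ f.of
    rw [← ε_eq, MonoidalCategory.tensorHom_def, Category.assoc, Category.assoc,
      ← Functor.LaxMonoidal.right_unitality]
    exact MonoidalCategory.rightUnitor_naturality f.of)
  (pentagon := fun W X Y Z => by
    rw [id_eq_toKleisli Z, id_eq_toKleisli W]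
    have := congrArg (Adjunction.toKleisli T).map (MonoidalCategory.pentagon W.of X.of Y.of Z.of)
    simp only [Functor.map_comp, ← MonoidalCategory.tensorHom_id,
      ← MonoidalCategory.id_tensorHom, ← tensor_toKleisli] at this
    exact this)
  (triangle := fun X Y => by
    rw [id_eq_toKleisli X, id_eq_toKleisli Y]
    have := congrArg (Adjunction.toKleisli T).map (MonoidalCategory.triangle X.of Y.of)
    simp only [Functor.map_comp, ← MonoidalCategory.tensorHom_id,
      ← MonoidalCategory.id_tensorHom, ← tensor_toKleisli] at this
    exact this)

theorem whiskerLeft_toKleisli (X : D) {A B : D} (f : A ⟶ B) :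
    Kleisli.mk T X ◁ (Adjunction.toKleisli T).map f = (Adjunction.toKleisli T).map (X ◁ f) := by
  rw [← MonoidalCategory.id_tensorHom, ← MonoidalCategory.id_tensorHom, ← tensor_toKleisli,
    id_eq_toKleisli]
  rfl

theorem toKleisli_whiskerRight {A B : D} (f : A ⟶ B) (X : D) :
    (Adjunction.toKleisli T).map f ▷ Kleisli.mk T X = (Adjunction.toKleisli T).map (f ▷ X) := by
  rw [← MonoidalCategory.tensorHom_id, ← MonoidalCategory.tensorHom_id, ← tensor_toKleisli,
    id_eq_toKleisli]
  rfl

end Monoidal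

section Symmetric

variable [MonoidalCategory D] [SymmetricCategory D] [T.SymmetricMonoidal]

/-- The symmetry of `Kl(T)` is the image of the symmetry of `D`. -/
instance : SymmetricCategory (Kleisli T) where
  braiding X Y := (Adjunction.toKleisli T).mapIso (β_ X.of Y.of)
  braiding_naturality_right X {Y Z} f := by
    ext
    refine (comp_toKleisli_of _ _).trans (.trans ?_ (toKleisli_comp_of _ _).symm)
    change ((T.η.app X.of ⊗ₘ f.of) ≫ T.nabla _ _) ≫ T.map (β_ X.of Z.of).hom =
      _ ≫ (f.of ⊗ₘ T.η.app X.of) ≫ T.nabla _ _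
    rw [Category.assoc, Functor.LaxBraided.braided, BraidedCategory.braiding_naturality_assoc]
    rfl
  braiding_naturality_left {Y Z} f X := by
    ext
    refine (comp_toKleisli_of _ _).trans (.trans ?_ (toKleisli_comp_of _ _).symm)
    change ((f.of ⊗ₘ T.η.app X.of) ≫ T.nabla _ _) ≫ T.map (β_ Z.of X.of).hom =
      _ ≫ (T.η.app X.of ⊗ₘ f.of) ≫ T.nabla _ _
    rw [Category.assoc, Functor.LaxBraided.braided, BraidedCategory.braiding_naturality_assoc]
    rfl
  hexagon_forward X Y Z := by
    have := congrArg (Adjunction.toKleisli T).map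
      (BraidedCategory.hexagon_forward X.of Y.of Z.of)
    simp only [Functor.map_comp, ← whiskerLeft_toKleisli, ← toKleisli_whiskerRight] at this
    exact this
  hexagon_reverse X Y Z := by
    have := congrArg (Adjunction.toKleisli T).map
      (BraidedCategory.hexagon_reverse X.of Y.of Z.of)
    simp only [Functor.map_comp, ← whiskerLeft_toKleisli, ← toKleisli_whiskerRight] at this
    exact this
  symmetry X Y := by
    have := congrArg (Adjunction.toKleisli T).map (SymmetricCategory.symmetry X.of Y.of)
    simp only [Functor.map_comp, Functor.map_id] at this
    exact this

theorem toKleisli_tensorμ (X₁ X₂ Y₁ Y₂ : D) :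
    tensorμ (Kleisli.mk T X₁) (Kleisli.mk T X₂) (Kleisli.mk T Y₁) (Kleisli.mk T Y₂) =
      (Adjunction.toKleisli T).map (tensorμ X₁ X₂ Y₁ Y₂) := by
  simp only [tensorμ, Functor.map_comp, ← whiskerLeft_toKleisli, ← toKleisli_whiskerRight]
  rfl

end Symmetric

section Markov

variable [CartesianMonoidalCategory D] [SymmetricCategory D] [T.SymmetricMonoidal]

/-- Copying in `Kl(T)` is the image of the diagonal of `D`, and discarding is the image of the
map to the terminal object. -/
abbrev comonObj (X : Kleisli T) : ComonObj X where
  counit := (Adjunction.toKleisli T).map (toUnit X.of)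
  comul := (Adjunction.toKleisli T).map (lift (𝟙 X.of) (𝟙 X.of))
  counit_comul := by
    have : lift (𝟙 X.of) (𝟙 X.of) ≫ toUnit X.of ▷ X.of = (λ_ X.of).inv := by
      ext; simp
    have := congrArg (Adjunction.toKleisli T).map this
    simp only [Functor.map_comp, ← toKleisli_whiskerRight] at this
    exact this
  comul_counit := by
    have : lift (𝟙 X.of) (𝟙 X.of) ≫ X.of ◁ toUnit X.of = (ρ_ X.of).inv := by
      ext; simp
    have := congrArg (Adjunction.toKleisli T).map this
    simp only [Functor.map_comp, ← whiskerLeft_toKleisli] at this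
    exact this
  comul_assoc := by
    have : lift (𝟙 X.of) (𝟙 X.of) ≫ X.of ◁ lift (𝟙 X.of) (𝟙 X.of) =
        lift (𝟙 X.of) (𝟙 X.of) ≫ lift (𝟙 X.of) (𝟙 X.of) ▷ X.of ≫ (α_ X.of X.of X.of).hom := by
      ext <;> simp
    have := congrArg (Adjunction.toKleisli T).map this
    simp only [Functor.map_comp, ← whiskerLeft_toKleisli, ← toKleisli_whiskerRight] at this
    exact this

/-- `Kl(T)` is a Markov category for an affine symmetric monoidal monad `T` on a cartesian
monoidal category. -/
instance markovCategory [T.Affine] : MarkovCategory (Kleisli T) where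
  comonObj := comonObj
  isCommComonObj X := @IsCommComonObj.mk _ _ _ _ _ (comonObj X) (by
    have : lift (𝟙 X.of) (𝟙 X.of) ≫ (β_ X.of X.of).hom = lift (𝟙 X.of) (𝟙 X.of) := by
      ext <;> simp
    have := congrArg (Adjunction.toKleisli T).map this
    simp only [Functor.map_comp] at this
    exact this)
  copy_tensor X Y := by
    have : lift (𝟙 (X.of ⊗ Y.of)) (𝟙 (X.of ⊗ Y.of)) =
        (lift (𝟙 X.of) (𝟙 X.of) ⊗ₘ lift (𝟙 Y.of) (𝟙 Y.of)) ≫ tensorμ X.of X.of Y.of Y.of := by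
      ext <;> simp [tensorμ]
    have := congrArg (Adjunction.toKleisli T).map this
    simp only [Functor.map_comp, ← tensor_toKleisli, ← toKleisli_tensorμ] at this
    exact this
  discard_tensor X Y := by
    have : toUnit (X.of ⊗ Y.of) = (toUnit X.of ⊗ₘ toUnit Y.of) ≫ (λ_ (𝟙_ D)).hom :=
      toUnit_unique _ _
    have := congrArg (Adjunction.toKleisli T).map this
    simp only [Functor.map_comp, ← tensor_toKleisli] at this
    exact this
  copy_unit := by
    have : lift (𝟙 (𝟙_ D)) (𝟙 (𝟙_ D)) = (λ_ (𝟙_ D)).inv := by ext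
    exact congrArg (Adjunction.toKleisli T).map this
  discard_unit := by
    have : toUnit (𝟙_ D) = 𝟙 (𝟙_ D) := toUnit_unique _ _
    have := congrArg (Adjunction.toKleisli T).map this
    simp only [Functor.map_id] at this
    exact this
  discard_natural f := by
    ext
    obtain ⟨e⟩ := Monad.Affine.nonempty_iso (T := T)
    rw [← cancel_mono e.hom]
    exact toUnit_unique _ _

end Markov

end Kleisli

/-- An isomorphism of Markov categories: a symmetric monoidal isomorphism of categories, strict in
the sense that its coherence maps are identities, which preserves the copy maps. (Discarding is
preserved automatically.) -/
structure MarkovIso (C : Type*) [Category* C] [MonoidalCategory C] [MarkovCategory C]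
    (D : Type*) [Category* D] [MonoidalCategory D] [MarkovCategory D] where
  functor : C ⥤ D
  inverse : D ⥤ C
  functor_inverse : functor ⋙ inverse = 𝟭 C
  inverse_functor : inverse ⋙ functor = 𝟭 D
  braided : functor.Braided
  obj_unit : 𝟙_ D = functor.obj (𝟙_ C)
  obj_tensor (X Y : C) : functor.obj X ⊗ functor.obj Y = functor.obj (X ⊗ Y)
  ε_eq : Functor.LaxMonoidal.ε functor = eqToHom obj_unit
  μ_eq (X Y : C) : Functor.LaxMonoidal.μ functor X Y = eqToHom (obj_tensor X Y)
  map_copy (X : C) : functor.map Δ[X] = Δ[functor.obj X] ≫ Functor.LaxMonoidal.μ functor X X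

/-- A distribution object for `X`: an object `P` with a sampling map `samp : P ⟶ X` such that
composition with `samp` is a bijection from deterministic morphisms `A ⟶ P` to morphisms
`A ⟶ X`, for every `A`. -/
structure DistributionObject {C : Type u} [Category.{v} C] [MonoidalCategory C] [MarkovCategory C]
    (X : C) where
  obj : C
  samp : obj ⟶ X
  bijective (A : Det C) :
    Function.Bijective fun f : A ⟶ (⟨obj⟩ : Det C) => (Det.incl C).map f ≫ samp

/-- A Markov category is representable if every object has a distribution object. -/
def IsRepresentable (C : Type u) [Category.{v} C] [MonoidalCategory C] [MarkovCategory C] : Prop :=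
  ∀ X : C, Nonempty (DistributionObject X)

/-- The square with sides `δ`, `(δ, δ)`, `T (id, id)` and `∇` is a pullback for every object. -/
def Monad.DeltaPullback [CartesianMonoidalCategory D] [BraidedCategory D] (T : Monad D)
    [T.SymmetricMonoidal] : Prop :=
  ∀ X : D, IsPullback (T.η.app X) (lift (T.η.app X) (T.η.app X))
    (T.map (lift (𝟙 X) (𝟙 X))) (T.nabla X X)

end Kleisli

end CategoryTheory

open CategoryTheory

/-!
A Markov category `C` is representable iff the inclusion `C_det ⥤ C` has a right adjoint `R`, the
sampling maps being its counit. The inclusion is a strict symmetric monoidal functor, so by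
doctrinal adjunction `R` is lax symmetric monoidal and the induced monad `P` on `C_det` is a
symmetric monoidal monad; it is affine because `R` preserves the terminal object. The inclusion is
moreover the identity on objects, so the comparison between `C` and `Kl(P)` is an isomorphism. A
cone over the square of `∇` and `P (id, id)` says, after sampling, that copying the value of a
morphism `f` amounts to sampling `g₁` and `g₂` independently. Marginalizing gives `g₁ = f = g₂`, so
that `f` is deterministic, i.e. the cone factors through `δ`.

Conversely `C_det ⥤ Kl(P)` is a left adjoint, hence so is its composite with `Kl(P) ≅ C`, which is
the inclusion.
-/

universe v₁ u₁ v₂ u₂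

open MonoidalCategory CartesianMonoidalCategory ComonObj Limits
open Functor.LaxMonoidal Functor.OplaxMonoidal

section KleisliMorphisms

variable {C : Type u₁} [Category.{v₁} C] {D : Type u₂} [Category.{v₂} D] {F : D ⥤ C} {R : C ⥤ D}
  (adj : F ⊣ R)

/-- The correspondence between Kleisli morphisms for the monad of an adjunction `F ⊣ R` and
morphisms between objects in the image of `F`. For the inclusion of the deterministic morphisms it
is postcomposition with the sampling map. -/
def kleisliEquiv (T X : D) : (T ⟶ adj.toMonad.obj X) ≃ (F.obj T ⟶ F.obj X) :=
  (adj.homEquiv T (F.obj X)).symm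

theorem kleisliEquiv_apply {T X : D} (f : T ⟶ adj.toMonad.obj X) :
    kleisliEquiv adj T X f = F.map f ≫ adj.counit.app (F.obj X) :=
  adj.homEquiv_counit T (F.obj X) f

theorem kleisliEquiv_comp {S T X : D} (g : S ⟶ T) (f : T ⟶ adj.toMonad.obj X) :
    kleisliEquiv adj S X (g ≫ f) = F.map g ≫ kleisliEquiv adj T X f :=
  adj.homEquiv_naturality_left_symm g f

theorem kleisliEquiv_η (X : D) : kleisliEquiv adj X X (adj.toMonad.η.app X) = 𝟙 (F.obj X) :=
  (adj.homEquiv X _).symm_apply_eq.2 (adj.homEquiv_id X).symm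

theorem kleisliEquiv_comp_η {T X : D} (f : T ⟶ X) :
    kleisliEquiv adj T X (f ≫ adj.toMonad.η.app X) = F.map f := by
  rw [kleisliEquiv_comp]
  exact (_ ≫= kleisliEquiv_η adj X).trans (Category.comp_id _)

theorem kleisliEquiv_comp_map {T X Y : D} (f : T ⟶ adj.toMonad.obj X) (h : X ⟶ Y) :
    kleisliEquiv adj T Y (f ≫ adj.toMonad.map h) = kleisliEquiv adj T X f ≫ F.map h :=
  adj.homEquiv_naturality_right_symm f (F.map h)

theorem kleisliEquiv_comp_map_μ {T X Y : D} (f : T ⟶ adj.toMonad.obj X)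
    (g : X ⟶ adj.toMonad.obj Y) :
    kleisliEquiv adj T Y (f ≫ adj.toMonad.map g ≫ adj.toMonad.μ.app Y) =
      kleisliEquiv adj T X f ≫ kleisliEquiv adj X Y g := by
  have h : adj.toMonad.map g ≫ adj.toMonad.μ.app Y = R.map (kleisliEquiv adj X Y g) :=
    (R.map_comp _ _).symm.trans (congrArg R.map (kleisliEquiv_apply adj g).symm)
  rw [h]
  exact adj.homEquiv_naturality_right_symm f _

/-- The comparison functor from the Kleisli category of the monad of an adjunction `F ⊣ R`, which
is `F` on objects. -/
def fromKleisli : Kleisli adj.toMonad ⥤ C where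
  obj X := F.obj X.of
  map {X Y} f := kleisliEquiv adj X.of Y.of f.of
  map_id X := kleisliEquiv_η adj X.of
  map_comp f g := kleisliEquiv_comp_map_μ adj f.of g.of

end KleisliMorphisms

section DoctrinalAdjunction

variable {C : Type u₁} [Category.{v₁} C] [MonoidalCategory C]
  {D : Type u₂} [Category.{v₂} D] [MonoidalCategory D]
  {F : D ⥤ C} {R : C ⥤ D} (adj : F ⊣ R)

theorem isMonoidal_toMonad_μ [F.Monoidal] [R.LaxMonoidal] [adj.IsMonoidal] :
    NatTrans.IsMonoidal (F₁ := (F ⋙ R) ⋙ F ⋙ R) (F₂ := F ⋙ R) adj.toMonad.μ := by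
  have h : adj.toMonad.μ = (Functor.associator F R (F ⋙ R)).hom ≫
      Functor.whiskerLeft F ((Functor.associator R F R).inv ≫
        Functor.whiskerRight adj.counit R ≫ R.leftUnitor.hom) := by
    ext X
    change R.map (adj.counit.app (F.obj X)) = _
    simp
  rw [h]
  infer_instance

variable [BraidedCategory C] [BraidedCategory D] [F.Braided]

/-- Doctrinal adjunction: the right adjoint of a braided monoidal functor is lax braided, with
structure maps the mates of those of the left adjoint. -/
abbrev rightAdjointLaxBraided : R.LaxBraided where
  __ := adj.rightAdjointLaxMonoidal
  braided X Y := by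
    let := adj.rightAdjointLaxMonoidal
    apply (adj.homEquiv _ _).symm.injective
    simp [Adjunction.homEquiv_counit, adj.map_μ_comp_counit_app_tensor,
      adj.map_μ_comp_counit_app_tensor_assoc]

/-- The monad of an adjunction whose left adjoint is a braided monoidal functor is a symmetric
monoidal monad. -/
abbrev toMonadSymmetricMonoidal : adj.toMonad.SymmetricMonoidal :=
  letI := rightAdjointLaxBraided adj
  haveI : adj.IsMonoidal := inferInstanceAs (letI := adj.rightAdjointLaxMonoidal; adj.IsMonoidal)
  { laxBraided := inferInstanceAs (F ⋙ R).LaxBraided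
    isMonoidal_η := inferInstanceAs (NatTrans.IsMonoidal adj.unit)
    isMonoidal_μ := isMonoidal_toMonad_μ adj }

attribute [local instance] toMonadSymmetricMonoidal

theorem kleisliEquiv_nabla (X Y : D) :
    kleisliEquiv adj _ _ (adj.toMonad.nabla X Y) =
      δ F (adj.toMonad.obj X) (adj.toMonad.obj Y) ≫
        (adj.counit.app (F.obj X) ⊗ₘ adj.counit.app (F.obj Y)) ≫ μ F X Y := by
  let := adj.rightAdjointLaxMonoidal
  have h : F.map (μ (F ⋙ R) X Y) ≫ adj.counit.app (F.obj (X ⊗ Y)) =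
      δ F _ _ ≫ (adj.counit.app (F.obj X) ⊗ₘ adj.counit.app (F.obj Y)) ≫ μ F X Y := by
    simp [adj.map_μ_comp_counit_app_tensor_assoc]
  exact (kleisliEquiv_apply adj _).trans h

theorem kleisliEquiv_tensorHom_comp_nabla {S T X Y : D}
    (f : S ⟶ adj.toMonad.obj X) (g : T ⟶ adj.toMonad.obj Y) :
    kleisliEquiv adj (S ⊗ T) (X ⊗ Y) ((f ⊗ₘ g) ≫ adj.toMonad.nabla X Y) =
      δ F S T ≫ (kleisliEquiv adj S X f ⊗ₘ kleisliEquiv adj T Y g) ≫ μ F X Y := by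
  rw [kleisliEquiv_comp, kleisliEquiv_nabla, ← δ_natural_assoc, kleisliEquiv_apply,
    kleisliEquiv_apply]
  exact _ ≫= tensorHom_comp_tensorHom_assoc _ _ _ _ _

end DoctrinalAdjunction

theorem affine_toMonad {C : Type u₁} [Category.{v₁} C] [MonoidalCategory C]
    {D : Type u₂} [Category.{v₂} D] [CartesianMonoidalCategory D] {F : D ⥤ C} [F.Monoidal]
    {R : C ⥤ D} (adj : F ⊣ R) (hC : IsTerminal (𝟙_ C)) : adj.toMonad.Affine := by
  have : PreservesLimitsOfSize.{0, 0} R := adj.rightAdjoint_preservesLimits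
  have hF : IsTerminal (F.obj (𝟙_ D)) := hC.ofIso (Functor.Monoidal.εIso F)
  exact ⟨⟨(hF.isTerminalObj R).uniqueUpToIso isTerminalTensorUnit⟩⟩

section WideSubcategory

variable {C : Type u} [Category.{v} C] [MonoidalCategory C] [BraidedCategory C]
  (P : MorphismProperty C) [P.IsStableUnderBraiding]

instance : (wideSubcategoryInclusion P).Monoidal :=
  Monoidal.fromInducedMonoidal (wideSubcategoryInclusion P)
    { εIso := Iso.refl _, μIso _ _ := Iso.refl _ }

instance : (wideSubcategoryInclusion P).Braided where
  braided _ _ := (Category.id_comp _).trans (Category.comp_id _).symm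

end WideSubcategory

section MarkovCategory

variable {C : Type u} [Category.{v} C] [MonoidalCategory C] [MarkovCategory C]

theorem isRepresentable_iff_isLeftAdjoint : IsRepresentable C ↔ (Det.incl C).IsLeftAdjoint := by
  constructor
  · intro h
    let d X := (h X).some
    let e A X := (Equiv.ofBijective _ ((d X).bijective A)).symm
    refine (Adjunction.adjunctionOfEquivRight e fun A' A X f g => ?_).isLeftAdjoint
    have hg : (Det.incl C).map (e A X g) ≫ (d X).samp = g := (e A X).symm_apply_apply g
    rw [Equiv.symm_apply_eq]
    calc (Det.incl C).map f ≫ g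
        = (Det.incl C).map f ≫ (Det.incl C).map (e A X g) ≫ (d X).samp := by rw [hg]
      _ = (Det.incl C).map (f ≫ e A X g) ≫ (d X).samp := (Category.assoc _ _ _).symm
  · intro h X
    let adj := Adjunction.ofIsLeftAdjoint (Det.incl C)
    refine ⟨⟨((Det.incl C).rightAdjoint.obj X).obj, adj.counit.app X, fun A => ?_⟩⟩
    convert (adj.homEquiv A X).symm.bijective using 1
    ext f
    exact (adj.homEquiv_counit A X f).symm

theorem eq_and_eq_of_comp_copy {T X : C} {h g₁ g₂ : T ⟶ X}
    (w : h ≫ Δ[X] = Δ[T] ≫ (g₁ ⊗ₘ g₂)) : g₁ = h ∧ g₂ = h := by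
  have h₁ := copy_fst g₁ g₂
  have h₂ := copy_snd g₁ g₂
  rw [← w, Category.assoc] at h₁ h₂
  exact ⟨by simpa using h₁.symm, by simpa using h₂.symm⟩

theorem incl_map_diag (X : Det C) : (Det.incl C).map (lift (𝟙 X) (𝟙 X)) = Δ[X.obj] := by
  change Δ[X.obj] ≫ (𝟙 _ ⊗ₘ 𝟙 _) = _
  simp

variable {R : C ⥤ Det C} (adj : Det.incl C ⊣ R)

attribute [local instance] toMonadSymmetricMonoidal

theorem kleisliEquiv_incl_tensorHom_comp_nabla {S T X Y : Det C}
    (f : S ⟶ adj.toMonad.obj X) (g : T ⟶ adj.toMonad.obj Y) :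
    kleisliEquiv adj (S ⊗ T) (X ⊗ Y) ((f ⊗ₘ g) ≫ adj.toMonad.nabla X Y) =
      (kleisliEquiv adj S X f ⊗ₘ kleisliEquiv adj T Y g) :=
  (kleisliEquiv_tensorHom_comp_nabla adj f g).trans <|
    (Category.id_comp _).trans (Category.comp_id _)

theorem kleisliEquiv_lift_comp_nabla {T X Y : Det C}
    (f : T ⟶ adj.toMonad.obj X) (g : T ⟶ adj.toMonad.obj Y) :
    kleisliEquiv adj T (X ⊗ Y) (lift f g ≫ adj.toMonad.nabla X Y) =
      Δ[T.obj] ≫ (kleisliEquiv adj T X f ⊗ₘ kleisliEquiv adj T Y g) := by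
  have h : lift f g = lift (𝟙 T) (𝟙 T) ≫ (f ⊗ₘ g) := by simp
  rw [h, Category.assoc, kleisliEquiv_comp, kleisliEquiv_incl_tensorHom_comp_nabla, incl_map_diag]
  rfl

theorem comp_map_diag_eq_lift_comp_nabla_iff {T X : Det C} {f g₁ g₂ : T ⟶ adj.toMonad.obj X} :
    f ≫ adj.toMonad.map (lift (𝟙 X) (𝟙 X)) = lift g₁ g₂ ≫ adj.toMonad.nabla X X ↔
      kleisliEquiv adj T X f ≫ Δ[X.obj] =
        Δ[T.obj] ≫ (kleisliEquiv adj T X g₁ ⊗ₘ kleisliEquiv adj T X g₂) := by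
  rw [← kleisliEquiv_lift_comp_nabla, ← incl_map_diag,
    ← (kleisliEquiv adj T (X ⊗ X)).injective.eq_iff, kleisliEquiv_comp_map]
  rfl

theorem eq_lift_and_deterministic_of_comp_map_diag_eq {T X : Det C} {f : T ⟶ adj.toMonad.obj X}
    {g : T ⟶ adj.toMonad.obj X ⊗ adj.toMonad.obj X}
    (h : f ≫ adj.toMonad.map (lift (𝟙 X) (𝟙 X)) = g ≫ adj.toMonad.nabla X X) :
    g = lift f f ∧ deterministic C (kleisliEquiv adj T X f) := by
  obtain ⟨g₁, g₂, rfl⟩ : ∃ g₁ g₂, g = lift g₁ g₂ := ⟨g ≫ fst _ _, g ≫ snd _ _, by simp⟩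
  rw [comp_map_diag_eq_lift_comp_nabla_iff] at h
  obtain ⟨h₁, h₂⟩ := eq_and_eq_of_comp_copy h
  obtain rfl := (kleisliEquiv adj T X).injective h₁
  obtain rfl := (kleisliEquiv adj T X).injective h₂
  exact ⟨rfl, (deterministic_iff _).2 h⟩

theorem deltaPullback_toMonad : adj.toMonad.DeltaPullback := by
  intro X
  let P := adj.toMonad
  have hom_eq {T : Det C} (k : T ⟶ X) : kleisliEquiv adj T X (k ≫ P.η.app X) = k.hom :=
    kleisliEquiv_comp_η adj k
  let Cone := PullbackCone (P.map (lift (𝟙 X) (𝟙 X))) (P.nabla X X)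
  have eq_lift (s : Cone) := (eq_lift_and_deterministic_of_comp_map_diag_eq adj s.condition).1
  let factor (s : Cone) : s.pt ⟶ X :=
    ⟨kleisliEquiv adj s.pt X s.fst,
      (eq_lift_and_deterministic_of_comp_map_diag_eq adj s.condition).2⟩
  have factor_comp_η (s : Cone) : factor s ≫ P.η.app X = s.fst :=
    (kleisliEquiv adj _ X).injective (hom_eq _)
  refine ⟨⟨(comp_map_diag_eq_lift_comp_nabla_iff adj).2 ?_⟩, ⟨PullbackCone.IsLimit.mk _
    factor factor_comp_η (fun s => ?_) (fun s m h _ => ?_)⟩⟩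
  · have h : kleisliEquiv adj X X (P.η.app X) = 𝟙 X.obj := kleisliEquiv_η adj X
    change kleisliEquiv adj X X (P.η.app X) ≫ _ = _ ≫
      (kleisliEquiv adj X X (P.η.app X) ⊗ₘ kleisliEquiv adj X X (P.η.app X))
    rw [h]
    simp
  · rw [comp_lift, factor_comp_η]
    exact (eq_lift s).symm
  · ext
    exact (hom_eq m).symm.trans (congrArg _ h)

/-- The inverse of `fromKleisli` for the inclusion of the deterministic morphisms, which is the
identity on objects. -/
def extendToKleisli : C ⥤ Kleisli adj.toMonad where
  obj X := .mk _ ⟨X⟩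
  map {X Y} f := .mk ((kleisliEquiv adj ⟨X⟩ ⟨Y⟩).symm f)
  map_id X := Kleisli.hom_ext <| (Equiv.symm_apply_eq _).2 (kleisliEquiv_η adj ⟨X⟩).symm
  map_comp f g := by
    refine Kleisli.hom_ext <| (Equiv.symm_apply_eq _).2 ?_
    refine .trans ?_ (kleisliEquiv_comp_map_μ adj _ _).symm
    exact (congrArg₂ _ (Equiv.apply_symm_apply _ f) (Equiv.apply_symm_apply _ g)).symm

theorem extendToKleisli_map_incl {X Y : Det C} (f : X ⟶ Y) :
    (extendToKleisli adj).map ((Det.incl C).map f) =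
      (Kleisli.Adjunction.toKleisli adj.toMonad).map f :=
  Kleisli.hom_ext <| (Equiv.symm_apply_eq _).2 (kleisliEquiv_comp_η adj f).symm

theorem incl_comp_extendToKleisli :
    Det.incl C ⋙ extendToKleisli adj = Kleisli.Adjunction.toKleisli adj.toMonad :=
  CategoryTheory.Functor.ext (fun _ => rfl) fun _ _ f =>
    (extendToKleisli_map_incl adj f).trans
      ((Category.id_comp _).trans (Category.comp_id _)).symm

theorem extendToKleisli_comp_fromKleisli : extendToKleisli adj ⋙ fromKleisli adj = 𝟭 C :=
  CategoryTheory.Functor.ext (fun _ => rfl) fun _ _ f =>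
    (Equiv.apply_symm_apply _ f).trans ((Category.id_comp _).trans (Category.comp_id _)).symm

theorem fromKleisli_comp_extendToKleisli :
    fromKleisli adj ⋙ extendToKleisli adj = 𝟭 (Kleisli adj.toMonad) :=
  CategoryTheory.Functor.ext (fun _ => rfl) fun _ _ f =>
    (Kleisli.hom_ext (Equiv.symm_apply_apply _ f.of)).trans
      ((Category.id_comp _).trans (Category.comp_id _)).symm

theorem extendToKleisli_map_tensorHom {A B X Y : C} (f : A ⟶ X) (g : B ⟶ Y) :
    (extendToKleisli adj).map (f ⊗ₘ g) =
      (extendToKleisli adj).map f ⊗ₘ (extendToKleisli adj).map g := by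
  refine Kleisli.hom_ext <| (Equiv.symm_apply_eq _).2 (.symm ?_)
  refine (kleisliEquiv_incl_tensorHom_comp_nabla adj _ _).trans ?_
  exact congrArg₂ _ (Equiv.apply_symm_apply _ f) (Equiv.apply_symm_apply _ g)

theorem extendToKleisli_map_associator_hom (X Y Z : C) :
    (extendToKleisli adj).map (α_ X Y Z).hom =
      (α_ ((extendToKleisli adj).obj X) ((extendToKleisli adj).obj Y)
        ((extendToKleisli adj).obj Z)).hom :=
  extendToKleisli_map_incl adj (α_ (⟨X⟩ : Det C) ⟨Y⟩ ⟨Z⟩).hom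

theorem extendToKleisli_map_leftUnitor_hom (X : C) :
    (extendToKleisli adj).map (λ_ X).hom = (λ_ ((extendToKleisli adj).obj X)).hom :=
  extendToKleisli_map_incl adj (λ_ (⟨X⟩ : Det C)).hom

theorem extendToKleisli_map_rightUnitor_hom (X : C) :
    (extendToKleisli adj).map (ρ_ X).hom = (ρ_ ((extendToKleisli adj).obj X)).hom :=
  extendToKleisli_map_incl adj (ρ_ (⟨X⟩ : Det C)).hom

theorem extendToKleisli_map_braiding_hom (X Y : C) :
    (extendToKleisli adj).map (β_ X Y).hom =
      (β_ ((extendToKleisli adj).obj X) ((extendToKleisli adj).obj Y)).hom :=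
  extendToKleisli_map_incl adj (β_ (⟨X⟩ : Det C) ⟨Y⟩).hom

/-- The strict monoidal structure of `extendToKleisli`: its coherence maps are identities. -/
def extendToKleisliCoreMonoidal : (extendToKleisli adj).CoreMonoidal where
  εIso := Iso.refl ((extendToKleisli adj).obj (𝟙_ C))
  μIso X Y := Iso.refl ((extendToKleisli adj).obj (X ⊗ Y))
  μIso_hom_natural_left f Z := by
    rw [← tensorHom_id, ← tensorHom_id, extendToKleisli_map_tensorHom,
      (extendToKleisli adj).map_id]
    exact (Category.comp_id _).trans (Category.id_comp _).symm
  μIso_hom_natural_right Z f := by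
    rw [← id_tensorHom, ← id_tensorHom, extendToKleisli_map_tensorHom,
      (extendToKleisli adj).map_id]
    exact (Category.comp_id _).trans (Category.id_comp _).symm
  associativity X Y Z := by
    rw [extendToKleisli_map_associator_hom]
    let K := (extendToKleisli adj).obj
    change 𝟙 (K X ⊗ K Y) ▷ K Z ≫ 𝟙 ((K X ⊗ K Y) ⊗ K Z) ≫ (α_ (K X) (K Y) (K Z)).hom =
      (α_ (K X) (K Y) (K Z)).hom ≫ K X ◁ 𝟙 (K Y ⊗ K Z) ≫ 𝟙 (K X ⊗ K Y ⊗ K Z)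
    simp
  left_unitality X := by
    rw [extendToKleisli_map_leftUnitor_hom]
    let K := (extendToKleisli adj).obj
    change (λ_ (K X)).hom =
      𝟙 (𝟙_ (Kleisli adj.toMonad)) ▷ K X ≫ 𝟙 (𝟙_ (Kleisli adj.toMonad) ⊗ K X) ≫ (λ_ (K X)).hom
    simp
  right_unitality X := by
    rw [extendToKleisli_map_rightUnitor_hom]
    let K := (extendToKleisli adj).obj
    change (ρ_ (K X)).hom =
      K X ◁ 𝟙 (𝟙_ (Kleisli adj.toMonad)) ≫ 𝟙 (K X ⊗ 𝟙_ (Kleisli adj.toMonad)) ≫ (ρ_ (K X)).hom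
    simp

instance : (extendToKleisli adj).Braided where
  __ := (extendToKleisliCoreMonoidal adj).toMonoidal
  braided X Y :=
    (Category.id_comp _).trans <|
      (extendToKleisli_map_braiding_hom adj X Y).trans (Category.comp_id _).symm

/-- The isomorphism of Markov categories between `C` and the Kleisli category of the monad of
distribution objects. -/
def kleisliMarkovIso [adj.toMonad.Affine] : MarkovIso C (Kleisli adj.toMonad) where
  functor := extendToKleisli adj
  inverse := fromKleisli adj
  functor_inverse := extendToKleisli_comp_fromKleisli adj
  inverse_functor := fromKleisli_comp_extendToKleisli adj
  braided := inferInstance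
  obj_unit := rfl
  obj_tensor _ _ := rfl
  ε_eq := rfl
  μ_eq _ _ := rfl
  map_copy X := by
    have h := congrArg (extendToKleisli adj).map (incl_map_diag ⟨X⟩)
    exact h.symm.trans ((extendToKleisli_map_incl adj _).trans (Category.comp_id _).symm)

end MarkovCategory

theorem isLeftAdjoint_of_comp_eq_toKleisli {C : Type u₁} [Category.{v₁} C] {D : Type u₂}
    [Category.{v₂} D] {P : Monad D} {F : D ⥤ C} {Φ : C ⥤ Kleisli P} [Φ.IsEquivalence]
    (h : F ⋙ Φ = Kleisli.Adjunction.toKleisli P) : F.IsLeftAdjoint := by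
  have i : Kleisli.Adjunction.toKleisli P ⋙ Φ.inv ≅ F :=
    Functor.isoWhiskerRight (eqToIso h.symm) Φ.inv ≪≫ Functor.associator F Φ Φ.inv ≪≫
      Functor.isoWhiskerLeft F Φ.asEquivalence.unitIso.symm ≪≫ F.rightUnitor
  exact (((Kleisli.Adjunction.adj P).comp Φ.asEquivalence.symm.toAdjunction).ofNatIsoLeft
    i).isLeftAdjoint

theorem isEquivalence_markovIso_functor {C : Type u₁} [Category.{v₁} C] [MonoidalCategory C]
    [MarkovCategory C] {D : Type u₂} [Category.{v₂} D] [MonoidalCategory D] [MarkovCategory D]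
    (Φ : MarkovIso C D) : Φ.functor.IsEquivalence :=
  (CategoryTheory.Equivalence.mk Φ.functor Φ.inverse (eqToIso Φ.functor_inverse.symm)
    (eqToIso Φ.inverse_functor)).isEquivalence_functor

theorem theorem3p11 (C : Type u) [Category.{v} C] [MonoidalCategory C] [MarkovCategory C] :
    IsRepresentable C ↔
      ∃ (P : Monad (Det C)) (_ : P.SymmetricMonoidal) (_ : P.Affine),
        P.DeltaPullback ∧
        ∃ Φ : MarkovIso C (Kleisli P),
          Det.incl C ⋙ Φ.functor = Kleisli.Adjunction.toKleisli P := by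
  rw [isRepresentable_iff_isLeftAdjoint]
  constructor
  · intro h
    let adj := Adjunction.ofIsLeftAdjoint (Det.incl C)
    have affine : adj.toMonad.Affine := affine_toMonad adj MarkovCategory.isTerminalUnit
    exact ⟨adj.toMonad, toMonadSymmetricMonoidal adj, affine, deltaPullback_toMonad adj,
      kleisliMarkovIso adj, incl_comp_extendToKleisli adj⟩
  · rintro ⟨P, _, _, -, Φ, hΦ⟩
    have := isEquivalence_markovIso_functor Φ
    exact isLeftAdjoint_of_comp_eq_toKleisli hΦ
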